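/- Let $\Omega\subset\mathbb R^2$ be a bounded polygonal domain (connected, without slits, i.e. equal to the interior of its closure), and let $(\mathcal T_k)_{k=0,1,2,\dots}$ be conforming triangular grids of $\Omega$, each obtained from the one before by uniform refinement (every triangle is decomposed into four triangles by connecting the midpoints of its edges), such that every triangle has at least one vertex in $\Omega$. Let $h_k$ be the length of the largest edge of $\mathcal T_k$. Consider the Taylor–Hood element: $U_k$ is the space of continuous, piecewise quadratic vector fields $\overline\Omega\to\mathbb R^2$ on $\mathcal T_k$ that vanish on $\partial\Omega$, $P_k$ is the space of continuous, piecewise linear functions on $\mathcal T_k$ with mean value zero, and $X_k=U_k\times P_k$. Let $H^1_0(\Omega)$ be the closure of $C_c^\infty(\Omega)$ in $H^1(\Omega)$, equipped with the norm $\|v\|_{H^1(\Omega)}^2=\|v\|_{L^2(\Omega)}^2+\|\nabla v\|_{L^2(\Omega)}^2$, let $L^2_0(\Omega)$ be the space of all functions in $L^2(\Omega)$ with mean value zero, and let $A^*$ denote the dual space of $A$ with the dual norm, where $L^2$-functions act as functionals through the $L^2$-inner product. For $\beta>0$ and $x_k=(u_k,p_k)\in X_k$ define the scaled $L^2$-norm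 $$|||x_k|||_k^2=(h_k^{-2}+\beta)\,\|u_k\|_{L^2(\Omega)}^2+h_k^{-2}(\beta+h_k^{-2})^{-1}\|p_k\|_{L^2(\Omega)}^2$$ and the weak norm $$\|x_k\|_{X_{-,k}}^2=h_k^{-2}\left(\|u_k\|_{L^2(\Omega)}^2+\beta\|u_k\|_{[H^1_0(\Omega)^2]^*}^2\right)+h_k^{-2}\inf_{p_k=\ell+r}\left(\|\ell\|_{[H^1_0(\Omega)]^*}^2+\beta^{-1}\|r\|_{L^2(\Omega)}^2\right),$$ where the infimum is taken over all $\ell\in[H^1_0(\Omega)]^*$ and $r\in L^2_0(\Omega)$ such that $p_k=\ell+r$ holds in $[H^1_0(\Omega)\cap L^2_0(\Omega)]^*$. Then there is a constant $C>0$, which depends neither on $k$ nor on $\beta$, such that $$|||x_k|||_k\le C\,\|x_k\|_{X_{-,k}}\qquad\text{for all } k\in\{0,1,2,\dots\},\ \beta>0\text{ and } x_k\in X_k.$$ -/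

import Mathlib

open MeasureTheory Geometry
open scoped ContDiff Matrix RealInnerProductSpace

noncomputable section

namespace GenStokes

/-- The Euclidean plane. -/
abbrev Plane : Type := EuclideanSpace ℝ (Fin 2)

/-! ### Domains and grids -/

/-- A bounded polygonal domain of the plane: a nonempty connected bounded open set whose boundary
is covered by finitely many line segments and which lies, locally, on one side of its boundary
in the sense that it has no slits (it is the interior of its closure). -/
structure PolygonalDomain where
  carrier : Set Plane
  isOpen : IsOpen carrier
  isConnected : IsConnected carrier
  isBounded : Bornology.IsBounded carrier
  interior_closure : interior (closure carrier) = carrier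
  polygonal : ∃ S : Set (Plane × Plane), S.Finite ∧ frontier carrier ⊆ ⋃ e ∈ S, segment ℝ e.1 e.2

/-- The elements (triangles) of a grid, given by their sets of vertices. -/
def triangles (K : SimplicialComplex ℝ Plane) : Set (Finset Plane) :=
  {t | t ∈ K.faces ∧ t.card = 3}

/-- `K` is a (conforming) triangular grid of `Ω`. Conformity (two elements meet in a common
vertex, a common edge, or not at all) is part of Mathlib's notion of simplicial complex. -/
structure IsGrid (Ω : PolygonalDomain) (K : SimplicialComplex ℝ Plane) : Prop where
  finite : K.faces.Finite
  pure : ∀ s ∈ K.faces, ∃ t ∈ triangles K, s ⊆ t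
  space_eq : K.space = closure Ω.carrier

open Classical in
/-- The four triangles into which a triangle `t` is decomposed: for each vertex `v` of `t` the
triangle with the vertex `v` and the midpoints of the two edges at `v`, and the triangle whose
vertices are the midpoints of the three edges. -/
def subtriangles (t : Finset Plane) : Set (Finset Plane) :=
  {s | (∃ v ∈ t, s = t.image fun w => midpoint ℝ v w) ∨
    s = t.offDiag.image fun e => midpoint ℝ e.1 e.2}

/-- A sequence of grids of `Ω`, each obtained from the one before by uniform refinement. -/
structure GridSequence (Ω : PolygonalDomain) where
  grid : ℕ → SimplicialComplex ℝ Plane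
  isGrid : ∀ k, IsGrid Ω (grid k)
  refine : ∀ k, triangles (grid (k + 1)) = ⋃ t ∈ triangles (grid k), subtriangles t

/-- The grid size: the length of the largest edge. -/
def gridSize (K : SimplicialComplex ℝ Plane) : ℝ :=
  sSup {d | ∃ s ∈ K.faces, ∃ a ∈ s, ∃ b ∈ s, d = dist a b}

/-! ### Function spaces -/

/-- Lebesgue measure on `Ω`. -/
abbrev PolygonalDomain.vol (Ω : PolygonalDomain) : Measure Plane :=
  volume.restrict Ω.carrier

instance (Ω : PolygonalDomain) : IsFiniteMeasure Ω.vol :=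
  ⟨by simpa using Ω.isBounded.measure_lt_top⟩

/-- `L²(Ω)`. -/
abbrev L2 (Ω : PolygonalDomain) : Type := Lp ℝ 2 Ω.vol

/-- `[L²(Ω)]²`. -/
abbrev L2Vec (Ω : PolygonalDomain) : Type := PiLp 2 fun _ : Fin 2 => L2 Ω

/-- `L²₀(Ω)`, the functions of `L²(Ω)` with mean value zero. -/
def L20 (Ω : PolygonalDomain) : Submodule ℝ (L2 Ω) where
  carrier := {p | ∫ x, p x ∂Ω.vol = 0}
  zero_mem' := by
    have h := integral_congr_ae (Lp.coeFn_zero ℝ 2 Ω.vol)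
    simpa using h
  add_mem' := by
    intro p q hp hq
    have hp' : Integrable p Ω.vol := (Lp.memLp p).integrable one_le_two
    have hq' : Integrable q Ω.vol := (Lp.memLp q).integrable one_le_two
    simp only [Set.mem_ofPred_eq] at hp hq ⊢
    rw [integral_congr_ae (Lp.coeFn_add p q)]
    simp only [Pi.add_apply]
    rw [integral_add hp' hq', hp, hq, add_zero]
  smul_mem' := by
    intro c p hp
    simp only [Set.mem_ofPred_eq] at hp ⊢
    rw [integral_congr_ae (Lp.coeFn_smul c p)]
    simp only [Pi.smul_apply]
    rw [integral_smul, hp, smul_zero]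

/-- Pairs `(v, g)` of a scalar function and a vector field in `L²(Ω)`, with
`‖(v, g)‖² = ‖v‖²_{L²} + ‖g‖²_{L²}`. A function `v ∈ H¹(Ω)` is represented by the pair `(v, ∇v)`,
whose norm is the `H¹(Ω)`-norm of `v`. -/
abbrev FunGrad (Ω : PolygonalDomain) : Type := WithLp 2 (L2 Ω × Lp Plane 2 Ω.vol)

/-- The set of all `(φ, ∇φ)`, where `φ` is smooth with compact support in `Ω`. -/
def testPairs (Ω : PolygonalDomain) : Set (FunGrad Ω) :=
  {v | ∃ φ : Plane → ℝ, ContDiff ℝ ∞ φ ∧ HasCompactSupport φ ∧ tsupport φ ⊆ Ω.carrier ∧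
    v.fst =ᵐ[Ω.vol] φ ∧ v.snd =ᵐ[Ω.vol] gradient φ}

/-- `H¹₀(Ω)` with the `H¹(Ω)`-norm: the closure of the smooth functions with compact support in
`Ω` with respect to that norm, where a function `v` is represented by `(v, ∇v)`.
(`Submodule.span` only provides the vector space structure: `testPairs Ω` is a subspace.) -/
def H10 (Ω : PolygonalDomain) : Submodule ℝ (FunGrad Ω) :=
  (Submodule.span ℝ (testPairs Ω)).topologicalClosure

/-- `[H¹₀(Ω)]²`. -/
abbrev H10Vec (Ω : PolygonalDomain) : Type := PiLp 2 fun _ : Fin 2 => H10 Ω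

/-- The embedding of `H¹₀(Ω)` into `L²(Ω)`. -/
def toL2 (Ω : PolygonalDomain) : H10 Ω →L[ℝ] L2 Ω :=
  (WithLp.fstL 2 ℝ (L2 Ω) (Lp Plane 2 Ω.vol)).comp (H10 Ω).subtypeL

/-- `H¹₀(Ω) ∩ L²₀(Ω)`. -/
def H10L20 (Ω : PolygonalDomain) : Submodule ℝ (H10 Ω) :=
  (L20 Ω).comap (toL2 Ω).toLinearMap

/-- The space `P₋ = [H¹₀(Ω) ∩ L²₀(Ω)]^*`. -/
abbrev PMinus (Ω : PolygonalDomain) : Type := StrongDual ℝ (H10L20 Ω)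

/-- The functional `q ↦ (p, q)_{L²(Ω)}` on `H¹₀(Ω) ∩ L²₀(Ω)` given by `p ∈ L²(Ω)`. -/
def toPMinus (Ω : PolygonalDomain) (p : L2 Ω) : PMinus Ω :=
  (innerSL ℝ p).comp ((toL2 Ω).comp (H10L20 Ω).subtypeL)

/-- The functional `w ↦ (u, w)_{L²(Ω)}` on `[H¹₀(Ω)]²` given by `u ∈ [L²(Ω)]²`. -/
def toH10VecDual (Ω : PolygonalDomain) (u : L2Vec Ω) : StrongDual ℝ (H10Vec Ω) :=
  ∑ i : Fin 2, (innerSL ℝ (u i)).comp ((toL2 Ω).comp (PiLp.proj 2 (fun _ => H10 Ω) i))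

/-! ### The norm of `X₋` -/

/-- `‖u‖²_{L² ∩ β [H¹₀]^*} = ‖u‖²_{L²} + β ‖u‖²_{[H¹₀]^*}` for `u ∈ [L²(Ω)]²`. -/
def interNormSq (Ω : PolygonalDomain) (β : ℝ) (u : L2Vec Ω) : ℝ :=
  ‖u‖ ^ 2 + β * ‖toH10VecDual Ω u‖ ^ 2

/-- `‖F‖²_{[H¹₀]^* + β⁻¹ L²₀}` for `F ∈ P₋`: the infimum of `‖ℓ‖²_{[H¹₀]^*} + β⁻¹ ‖r‖²_{L²}` over
all decompositions `F = ℓ + r` (in `P₋`) with `ℓ ∈ [H¹₀(Ω)]^*` and `r ∈ L²₀(Ω)`. -/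
def sumNormSq (Ω : PolygonalDomain) (β : ℝ) (F : PMinus Ω) : ℝ :=
  sInf {m | ∃ (ℓ : StrongDual ℝ (H10 Ω)) (r : L20 Ω),
    F = ℓ.comp (H10L20 Ω).subtypeL + toPMinus Ω r ∧ m = ‖ℓ‖ ^ 2 + β⁻¹ * ‖r‖ ^ 2}

/-- The norm of `X₋ = [L²(Ω)]² × P₋` for the grid size `h`:
`‖(u, F)‖² = h⁻² ‖u‖²_{L² ∩ β [H¹₀]^*} + h⁻² ‖F‖²_{[H¹₀]^* + β⁻¹ L²₀}`. -/
def weakNorm (Ω : PolygonalDomain) (h β : ℝ) (u : L2Vec Ω) (F : PMinus Ω) : ℝ :=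
  √((h ^ 2)⁻¹ * interNormSq Ω β u + (h ^ 2)⁻¹ * sumNormSq Ω β F)

/-! ### The Taylor-Hood element -/

/-- The continuous functions on the closure of `Ω` (the underlying space of the grid `K`) that
are, on every element of `K`, polynomials of total degree at most `d`. The values outside of
the underlying space do not matter. -/
def lagrange (K : SimplicialComplex ℝ Plane) (d : ℕ) : Submodule ℝ (Plane → ℝ) where
  carrier := {f | ContinuousOn f K.space ∧ ∀ t ∈ triangles K, ∃ q : MvPolynomial (Fin 2) ℝ,
    q.totalDegree ≤ d ∧ ∀ x ∈ convexHull ℝ (t : Set Plane), f x = MvPolynomial.eval x.ofLp q}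
  zero_mem' := ⟨continuousOn_const, fun _ _ => ⟨0, by simp, by simp⟩⟩
  add_mem' := by
    rintro f g ⟨hf, hf'⟩ ⟨hg, hg'⟩
    refine ⟨hf.add hg, fun t ht => ?_⟩
    obtain ⟨q, hq, hfq⟩ := hf' t ht
    obtain ⟨r, hr, hgr⟩ := hg' t ht
    exact ⟨q + r, (MvPolynomial.totalDegree_add q r).trans (max_le hq hr),
      fun x hx => by simp [hfq x hx, hgr x hx]⟩
  smul_mem' := by
    rintro c f ⟨hf, hf'⟩
    refine ⟨hf.const_smul c, fun t ht => ?_⟩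
    obtain ⟨q, hq, hfq⟩ := hf' t ht
    exact ⟨c • q, (MvPolynomial.totalDegree_smul_le c q).trans hq,
      fun x hx => by simp [hfq x hx, MvPolynomial.smul_eval]⟩

/-- The velocity space `U_k` on the grid `K`: both components are continuous, piecewise
quadratic and vanish on the boundary of `Ω`. -/
def velocitySpace (Ω : PolygonalDomain) (K : SimplicialComplex ℝ Plane) :
    Submodule ℝ (L2Vec Ω) where
  carrier := {u | ∀ i, ∃ f ∈ lagrange K 2,
    (∀ x ∈ frontier Ω.carrier, f x = 0) ∧ u i =ᵐ[Ω.vol] f}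
  zero_mem' := fun _ => ⟨0, zero_mem _, by simp, Lp.coeFn_zero ℝ 2 Ω.vol⟩
  add_mem' := by
    intro u v hu hv i
    obtain ⟨f, hf, hf0, huf⟩ := hu i
    obtain ⟨g, hg, hg0, hvg⟩ := hv i
    exact ⟨f + g, add_mem hf hg, fun x hx => by simp [hf0 x hx, hg0 x hx],
      (Lp.coeFn_add (u i) (v i)).trans (huf.add hvg)⟩
  smul_mem' := by
    intro c u hu i
    obtain ⟨f, hf, hf0, huf⟩ := hu i
    exact ⟨c • f, Submodule.smul_mem _ c hf, fun x hx => by simp [hf0 x hx],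
      (Lp.coeFn_smul c (u i)).trans (huf.const_smul c)⟩

/-- The pressure space `P_k` on the grid `K`: continuous, piecewise linear functions with mean
value zero. -/
def pressureSpace (Ω : PolygonalDomain) (K : SimplicialComplex ℝ Plane) :
    Submodule ℝ (L2 Ω) where
  carrier := {p | p ∈ L20 Ω ∧ ∃ f ∈ lagrange K 1, p =ᵐ[Ω.vol] f}
  zero_mem' := ⟨zero_mem _, 0, zero_mem _, Lp.coeFn_zero ℝ 2 Ω.vol⟩
  add_mem' := by
    rintro p q ⟨hp, f, hf, hpf⟩ ⟨hq, g, hg, hqg⟩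
    exact ⟨add_mem hp hq, f + g, add_mem hf hg, (Lp.coeFn_add p q).trans (hpf.add hqg)⟩
  smul_mem' := by
    rintro c p ⟨hp, f, hf, hpf⟩
    exact ⟨Submodule.smul_mem _ c hp, c • f, Submodule.smul_mem _ c hf,
      (Lp.coeFn_smul c p).trans (hpf.const_smul c)⟩

/-! ### The scaled `L²`-norm -/

/-- The scaled `L²`-norm
`|||(u, p)|||² = (h⁻² + β) ‖u‖²_{L²} + h⁻² (β + h⁻²)⁻¹ ‖p‖²_{L²}` for the grid size `h`. -/
def scaledNorm (Ω : PolygonalDomain) (h β : ℝ) (u : L2Vec Ω) (p : L2 Ω) : ℝ :=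
  √(((h ^ 2)⁻¹ + β) * ‖u‖ ^ 2 + (h ^ 2)⁻¹ * (β + (h ^ 2)⁻¹)⁻¹ * ‖p‖ ^ 2)

/-- The mass matrix of a basis of a space of `L²`-functions represents the `L²`-norm. -/
theorem massMatrix_form {V ι : Type*} [NormedAddCommGroup V] [InnerProductSpace ℝ V] [Fintype ι]
    {S : Submodule ℝ V} (b : Module.Basis ι ℝ S) (x : S) :
    (Matrix.gram ℝ (fun i => (b i : V)) *ᵥ b.repr x) ⬝ᵥ b.repr x = ‖(x : V)‖ ^ 2 := by
  have hx : (x : V) = ∑ i, b.repr x i • (b i : V) := by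
    have h := congrArg (Submodule.subtype S) (b.sum_repr x)
    rw [map_sum] at h
    exact h.symm
  rw [← real_inner_self_eq_norm_sq]
  conv_rhs => rw [hx]
  simp only [sum_inner, inner_sum, real_inner_smul_left, real_inner_smul_right, dotProduct,
    Matrix.mulVec, Matrix.gram_apply, Finset.sum_mul]
  refine Finset.sum_congr rfl fun i _ => Finset.sum_congr rfl fun j _ => ?_
  rw [real_inner_comm]
  ring

/-- With respect to any bases of `U_k` and `P_k`, the scaled `L²`-norm is
`(L x, x)^{1/2}`, where `x` is the coefficient vector and `L` the block-diagonal matrix of the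
scaled mass matrices. -/
theorem scaledNorm_eq_massMatrix {ι κ : Type*} [Fintype ι] [Fintype κ] (Ω : PolygonalDomain)
    (K : SimplicialComplex ℝ Plane) (bU : Module.Basis ι ℝ (velocitySpace Ω K))
    (bP : Module.Basis κ ℝ (pressureSpace Ω K)) (h β : ℝ) (u : velocitySpace Ω K)
    (p : pressureSpace Ω K) :
    scaledNorm Ω h β u p =
      √((Matrix.fromBlocks (((h ^ 2)⁻¹ + β) • Matrix.gram ℝ fun i => (bU i : L2Vec Ω)) 0 0
          (((h ^ 2)⁻¹ * (β + (h ^ 2)⁻¹)⁻¹) • Matrix.gram ℝ fun i => (bP i : L2 Ω)) *ᵥ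
        Sum.elim (bU.repr u) (bP.repr p)) ⬝ᵥ Sum.elim (bU.repr u) (bP.repr p)) := by
  rw [scaledNorm, ← massMatrix_form bU u, ← massMatrix_form bP p, Matrix.fromBlocks_mulVec]
  simp [Matrix.smul_mulVec]

end GenStokes

end

noncomputable section

namespace GenStokes

open scoped Pointwise

/-! ### Geometry of grids -/

/-! Both weak norms are tested with a function that imitates the discrete one. If $f$ is a
polynomial of degree at most two on every element, replace it on each open element by a smooth
function with compact support there and the same moments against all quadratic polynomials. Extended
by zero, the pieces add up to some $w\in H^1_0(\Omega)$ with $(f,w)=\|f\|^2$, the same mean value as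
$f$, $\|w\|_{L^2}^2\le C\|f\|^2$ and $\|w\|_{H^1}^2\le D h_k^{-2}\|f\|^2$ (`IsGrid.exists_test`).
The test functions need not be discrete, so no inf-sup condition enters.

The constants are uniform in $k$ because refinement creates no new shapes: every element is a
translate of an initial triangle scaled by $\pm2^{-k}$ (`GridSequence.exists_homothetic`). Bubbles
are built on the finitely many initial triangles (`exists_hasBubbles`) and transported; a gradient
then costs $2^k$, which is at most $h_0h_k^{-1}$ (`GridSequence.gridSize_le`).

For the velocity this gives the inverse inequality $\|u\|^2\le Dh_k^{-2}\|u\|^2_{[H^1_0]^*}$, which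
controls the term $\beta\|u\|^2$. For a pressure $p=\ell+r$, the function $w$ has mean value zero
and is therefore admissible, so $\|p\|^2=\ell(w)+(r,w)$ is bounded by pairing $\ell$ with the
$H^1$-bound and $r$ with the $L^2$-bound. -/

theorem subtriangles_homothetic {t s : Finset Plane} (ht : t.card = 3) (hs : s ∈ subtriangles t) :
    ∃ (a : Plane) (c : ℝ), |c| = 2⁻¹ ∧ (s : Set Plane) = a +ᵥ c • (t : Set Plane) := by
  classical
  rcases hs with ⟨v, -, rfl⟩ | rfl
  · refine ⟨(2⁻¹ : ℝ) • v, 2⁻¹, by norm_num, ?_⟩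
    ext x
    simp [Set.mem_vadd_set, Set.mem_smul_set, midpoint_eq_smul_add]
  · obtain ⟨p, q, r, hpq, hpr, hqr, rfl⟩ := Finset.card_eq_three.1 ht
    refine ⟨(2⁻¹ : ℝ) • (p + q + r), -2⁻¹, by norm_num, ?_⟩
    have h1 : (2⁻¹ : ℝ) • (p + q + r) + -(2⁻¹ : ℝ) • p = midpoint ℝ q r := by
      rw [midpoint_eq_smul_add]; simp only [invOf_eq_inv]; module
    have h2 : (2⁻¹ : ℝ) • (p + q + r) + -(2⁻¹ : ℝ) • q = midpoint ℝ p r := by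
      rw [midpoint_eq_smul_add]; simp only [invOf_eq_inv]; module
    have h3 : (2⁻¹ : ℝ) • (p + q + r) + -(2⁻¹ : ℝ) • r = midpoint ℝ p q := by
      rw [midpoint_eq_smul_add]; simp only [invOf_eq_inv]; module
    ext x
    simp only [Set.mem_vadd_set, Set.mem_smul_set, Finset.coe_image, Set.mem_image,
      Finset.mem_coe, Finset.mem_offDiag, vadd_eq_add, Finset.mem_insert,
      Finset.mem_singleton, Prod.exists]
    constructor
    · rintro ⟨y, z, ⟨hy, hz, hyz⟩, rfl⟩
      rcases hy with rfl | rfl | rfl <;> rcases hz with rfl | rfl | rfl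
      · exact absurd rfl hyz
      · exact ⟨_, ⟨r, by simp, rfl⟩, h3⟩
      · exact ⟨_, ⟨q, by simp, rfl⟩, h2⟩
      · exact ⟨_, ⟨r, by simp, rfl⟩, h3.trans (midpoint_comm ..)⟩
      · exact absurd rfl hyz
      · exact ⟨_, ⟨p, by simp, rfl⟩, h1⟩
      · exact ⟨_, ⟨q, by simp, rfl⟩, h2.trans (midpoint_comm ..)⟩
      · exact ⟨_, ⟨p, by simp, rfl⟩, h1.trans (midpoint_comm ..)⟩
      · exact absurd rfl hyz
    · rintro ⟨_, ⟨y, hy, rfl⟩, rfl⟩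
      rcases hy with rfl | rfl | rfl
      · exact ⟨q, r, ⟨by simp, by simp, hqr⟩, h1.symm⟩
      · exact ⟨p, r, ⟨by simp, by simp, hpr⟩, h2.symm⟩
      · exact ⟨p, q, ⟨by simp, by simp, hpq⟩, h3.symm⟩

theorem GridSequence.exists_homothetic {Ω : PolygonalDomain} (G : GridSequence Ω) (k : ℕ) :
    ∀ t ∈ triangles (G.grid k), ∃ t₀ ∈ triangles (G.grid 0), ∃ (a : Plane) (c : ℝ),
      |c| = (2⁻¹ : ℝ) ^ k ∧ (t : Set Plane) = a +ᵥ c • (t₀ : Set Plane) := by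
  induction k with
  | zero => exact fun t ht => ⟨t, ht, 0, 1, by simp, by simp⟩
  | succ k ih =>
    intro s hs
    rw [G.refine] at hs
    simp only [Set.mem_iUnion] at hs
    obtain ⟨t, ht, hst⟩ := hs
    obtain ⟨t₀, ht₀, a, c, hc, h⟩ := ih t ht
    obtain ⟨b, d, hd, h'⟩ := subtriangles_homothetic ht.2 hst
    refine ⟨t₀, ht₀, b + d • a, d * c, by rw [abs_mul, hc, hd, pow_succ, mul_comm], ?_⟩
    rw [h', h]
    ext x
    simp only [Set.mem_vadd_set, Set.mem_smul_set, exists_exists_and_eq_and, vadd_eq_add]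
    simp only [smul_add, mul_smul, add_assoc]

/-- The interior of the triangle with vertices `t`. -/
abbrev cell (t : Finset Plane) : Set Plane := interior (convexHull ℝ (t : Set Plane))

theorem cell_homothetic {t t₀ : Finset Plane} {a : Plane} {c : ℝ} (hc : c ≠ 0)
    (h : (t : Set Plane) = a +ᵥ c • (t₀ : Set Plane)) : cell t = a +ᵥ c • cell t₀ := by
  rw [cell, cell, h, convexHull_vadd, convexHull_smul, interior_vadd, interior_smul₀ hc]

theorem cell_nonempty {K : SimplicialComplex ℝ Plane} {t : Finset Plane} (ht : t ∈ triangles K) :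
    (cell t).Nonempty := by
  rw [cell, interior_convexHull_nonempty_iff_affineSpan_eq_top]
  have h := K.indep ht.1
  have := h.affineSpan_eq_top_iff_card_eq_finrank_add_one.2 (by simp [ht.2])
  simpa using this

/-- By conformity the two closed triangles meet inside the hull of their common vertices. A vertex
of `s` is missing there, so by affine independence these vertices do not span the plane and their
hull has empty interior. -/
theorem cell_disjoint {K : SimplicialComplex ℝ Plane} {s t : Finset Plane}
    (hs : s ∈ triangles K) (ht : t ∈ triangles K) (hst : s ≠ t) : Disjoint (cell s) (cell t) := by
  rw [Set.disjoint_iff_inter_eq_empty, cell, cell, ← interior_inter,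
    ← Set.not_nonempty_iff_eq_empty]
  intro h
  replace h := h.mono (interior_mono (K.inter_subset_convexHull hs.1 ht.1))
  rw [interior_convexHull_nonempty_iff_affineSpan_eq_top] at h
  have hne : ¬ s ⊆ t := fun hsub => hst (Finset.eq_of_subset_of_card_le hsub (by rw [hs.2, ht.2]))
  obtain ⟨v, hv, hvt⟩ := Finset.not_subset.1 hne
  have := (K.indep hs.1).notMem_affineSpan_sdiff ⟨v, hv⟩ Set.univ
  apply this
  have hsub : (s ∩ t : Set Plane) ⊆ (fun x : s => (x : Plane)) '' (Set.univ \ {⟨v, hv⟩}) := by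
    rintro x ⟨hx, hx'⟩
    refine ⟨⟨x, hx⟩, ⟨trivial, ?_⟩, rfl⟩
    rintro h
    rw [Set.mem_singleton_iff, Subtype.mk.injEq] at h
    subst h
    exact hvt hx'
  exact affineSpan_mono ℝ hsub (h ▸ AffineSubspace.mem_top ℝ Plane v)

theorem isBounded_cell (t : Finset Plane) : Bornology.IsBounded (cell t) :=
  (isBounded_convexHull.2 t.finite_toSet.isBounded).subset interior_subset

variable {Ω : PolygonalDomain} {K : SimplicialComplex ℝ Plane}

theorem IsGrid.finite_triangles (hK : IsGrid Ω K) : (triangles K).Finite :=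
  hK.finite.subset fun _ ht => ht.1

theorem IsGrid.cell_subset (hK : IsGrid Ω K) {t : Finset Plane} (ht : t ∈ triangles K) :
    cell t ⊆ Ω.carrier := by
  rw [← Ω.interior_closure, ← hK.space_eq]
  exact interior_mono (SimplicialComplex.convexHull_subset_space ht.1)

/-- Up to a null set, the domain is the union of the open elements of a grid. -/
theorem IsGrid.ae_eq (hK : IsGrid Ω K) :
    Ω.carrier =ᵐ[volume] ⋃ t ∈ hK.finite_triangles.toFinset, cell t := by
  refine Filter.EventuallyLE.antisymm ?_ (Set.iUnion₂_subset fun t ht =>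
    hK.cell_subset (by simpa using ht)).eventuallyLE
  -- Every point of the domain lies in some closed element, and the boundary of a convex set is a
  -- null set.
  have h0 : volume (⋃ t ∈ triangles K, frontier (convexHull ℝ (t : Set Plane))) = 0 := by
    rw [measure_biUnion_null_iff hK.finite_triangles.countable]
    exact fun t _ => (convex_convexHull ℝ _).addHaar_frontier _
  rw [ae_le_set]
  refine measure_mono_null ?_ h0
  rintro x ⟨hx, hx'⟩
  have hxs : x ∈ K.space := hK.space_eq ▸ subset_closure hx
  obtain ⟨s, hs, hxs⟩ := SimplicialComplex.mem_space_iff.1 hxs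
  obtain ⟨t, ht, hst⟩ := hK.pure s hs
  simp only [Set.mem_iUnion, Set.Finite.mem_toFinset, not_exists] at hx' ⊢
  exact ⟨t, ht, subset_closure (convexHull_mono (by exact_mod_cast hst) hxs), hx' t ht⟩

theorem IsGrid.vol_eq (hK : IsGrid Ω K) :
    Ω.vol = volume.restrict (⋃ t ∈ hK.finite_triangles.toFinset, cell t) :=
  Measure.restrict_congr_set hK.ae_eq

theorem IsGrid.setIntegral_eq (hK : IsGrid Ω K) {f : Plane → ℝ} (hf : Integrable f Ω.vol) :
    ∫ x, f x ∂Ω.vol = ∑ t ∈ hK.finite_triangles.toFinset, ∫ x in cell t, f x := by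
  rw [hK.vol_eq, integral_biUnion_finset _ fun t _ => isOpen_interior.measurableSet]
  · intro s hs t ht hst
    exact cell_disjoint (by simpa using hs) (by simpa using ht) hst
  · exact fun t ht => IntegrableOn.mono_set hf (hK.cell_subset (by simpa using ht))

/-! ### The grid size -/

theorem bddAbove_edges (hK : IsGrid Ω K) :
    BddAbove {d | ∃ s ∈ K.faces, ∃ a ∈ s, ∃ b ∈ s, d = dist a b} := by
  obtain ⟨M, hM⟩ := Metric.isBounded_iff.1 Ω.isBounded.closure
  refine ⟨M, ?_⟩
  rintro d ⟨s, hs, a, ha, b, hb, rfl⟩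
  have := SimplicialComplex.subset_space hs
  rw [hK.space_eq] at this
  exact hM (this ha) (this hb)

theorem exists_triangle (hK : IsGrid Ω K) : (triangles K).Nonempty := by
  obtain ⟨x, hx⟩ := Ω.isConnected.nonempty
  have hxs : x ∈ K.space := hK.space_eq ▸ subset_closure hx
  obtain ⟨s, hs, -⟩ := SimplicialComplex.mem_space_iff.1 hxs
  obtain ⟨t, ht, -⟩ := hK.pure s hs
  exact ⟨t, ht⟩

theorem gridSize_pos (hK : IsGrid Ω K) : 0 < gridSize K := by
  obtain ⟨t, ht⟩ := exists_triangle hK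
  obtain ⟨a, ha, b, hb, hab⟩ := Finset.one_lt_card.1 (by rw [ht.2]; norm_num : 1 < t.card)
  exact (dist_pos.2 hab).trans_le (le_csSup (bddAbove_edges hK) ⟨t, ht.1, a, ha, b, hb, rfl⟩)

/-- Any two vertices of an element are the images, under scaling by $\pm2^{-k}$ and a translation,
of two vertices of an initial triangle. The estimate serves to replace $4^k$ by $h_0^2h_k^{-2}$. -/
theorem GridSequence.gridSize_le (G : GridSequence Ω) (k : ℕ) :
    gridSize (G.grid k) ≤ (2⁻¹ : ℝ) ^ k * gridSize (G.grid 0) := by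
  refine csSup_le ?_ ?_
  · obtain ⟨t, ht⟩ := exists_triangle (G.isGrid k)
    obtain ⟨a, ha⟩ := SimplicialComplex.nonempty_of_mem_faces ht.1
    exact ⟨_, t, ht.1, a, ha, a, ha, rfl⟩
  · rintro d ⟨s, hs, a, ha, b, hb, rfl⟩
    obtain ⟨t, ht, hst⟩ := (G.isGrid k).pure s hs
    obtain ⟨t₀, ht₀, z, c, hc, h⟩ := G.exists_homothetic k t ht
    have ha' : a ∈ z +ᵥ c • (t₀ : Set Plane) := h ▸ (by exact_mod_cast hst ha)
    have hb' : b ∈ z +ᵥ c • (t₀ : Set Plane) := h ▸ (by exact_mod_cast hst hb)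
    obtain ⟨_, ⟨a₀, ha₀, rfl⟩, rfl⟩ := ha'
    obtain ⟨_, ⟨b₀, hb₀, rfl⟩, rfl⟩ := hb'
    simp only [vadd_eq_add, dist_add_left, dist_smul₀, Real.norm_eq_abs, hc]
    exact mul_le_mul_of_nonneg_left (le_csSup (bddAbove_edges (G.isGrid 0))
      ⟨t₀, ht₀.1, a₀, ha₀, b₀, hb₀, rfl⟩) (by positivity)

/-! ### Auxiliary facts about `L²` -/

theorem L2_norm_sq {E : Type*} [NormedAddCommGroup E] [InnerProductSpace ℝ E] {μ : Measure Plane}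
    (f : Lp E 2 μ) : ‖f‖ ^ 2 = ∫ x, ‖f x‖ ^ 2 ∂μ := by
  rw [← real_inner_self_eq_norm_sq, L2.inner_def]
  simp only [real_inner_self_eq_norm_sq]

theorem norm_toLp_sq {E : Type*} [NormedAddCommGroup E] [InnerProductSpace ℝ E]
    {μ : Measure Plane} {f : Plane → E} (hf : MemLp f 2 μ) :
    ‖hf.toLp f‖ ^ 2 = ∫ x, ‖f x‖ ^ 2 ∂μ := by
  rw [L2_norm_sq]
  refine integral_congr_ae ?_
  filter_upwards [hf.coeFn_toLp] with x hx
  rw [hx]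

/-- A linear map into functions of class `L²` as a linear map into the space `L²`. -/
def toLpLinear {V E : Type*} [AddCommGroup V] [Module ℝ V] [NormedAddCommGroup E]
    [NormedSpace ℝ E] {μ : Measure Plane} (A : V →ₗ[ℝ] Plane → E) (hA : ∀ v, MemLp (A v) 2 μ) :
    V →ₗ[ℝ] Lp E 2 μ where
  toFun v := (hA v).toLp (A v)
  map_add' v w := by
    rw [← MemLp.toLp_add]
    exact MemLp.toLp_congr _ _ (by rw [map_add])
  map_smul' c v := by
    rw [RingHom.id_apply, ← MemLp.toLp_const_smul]
    exact MemLp.toLp_congr _ _ (by rw [map_smul])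

theorem norm_toLpLinear_sq {V E : Type*} [AddCommGroup V] [Module ℝ V] [NormedAddCommGroup E]
    [InnerProductSpace ℝ E] {μ : Measure Plane} (A : V →ₗ[ℝ] Plane → E)
    (hA : ∀ v, MemLp (A v) 2 μ) (v : V) : ‖toLpLinear A hA v‖ ^ 2 = ∫ x, ‖A v x‖ ^ 2 ∂μ :=
  norm_toLp_sq (hA v)

/-- The map $A\circ J^{-1}$ is linear on the finite-dimensional range of $J$, hence bounded. -/
theorem exists_norm_le_of_injective {V E F : Type*} [AddCommGroup V] [Module ℝ V]
    [FiniteDimensional ℝ V] [NormedAddCommGroup E] [NormedSpace ℝ E] [NormedAddCommGroup F]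
    [NormedSpace ℝ F] (J : V →ₗ[ℝ] F) (hJ : Function.Injective J) (A : V →ₗ[ℝ] E) :
    ∃ C : ℝ, ∀ v, ‖A v‖ ≤ C * ‖J v‖ := by
  let e := LinearEquiv.ofInjective J hJ
  let L := LinearMap.toContinuousLinearMap (A ∘ₗ e.symm.toLinearMap)
  refine ⟨‖L‖, fun v => ?_⟩
  have h := L.le_opNorm (e v)
  simpa [L, e] using h

theorem continuous_gradient {φ : Plane → ℝ} (hφ : ContDiff ℝ ∞ φ) : Continuous (gradient φ) :=
  (InnerProductSpace.toDual ℝ Plane).symm.continuous.comp (hφ.continuous_fderiv (by simp))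

theorem tsupport_gradient_subset (φ : Plane → ℝ) : tsupport (gradient φ) ⊆ tsupport φ := by
  refine (closure_mono ?_).trans (tsupport_fderiv_subset ℝ (f := φ))
  intro x hx
  contrapose! hx
  simp only [Function.mem_support, not_not] at hx ⊢
  rw [gradient, hx, map_zero]

theorem hasCompactSupport_gradient {φ : Plane → ℝ} (hφ : HasCompactSupport φ) :
    HasCompactSupport (gradient φ) :=
  hφ.of_isClosed_subset (isClosed_tsupport _) (tsupport_gradient_subset φ)

/-! ### Bubble functions -/

/-- Quadratic polynomials in two variables. -/
abbrev Quad : Type := MvPolynomial.restrictTotalDegree (Fin 2) ℝ 2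

/-- The function on the plane given by a polynomial. -/
def evalFun : Quad →ₗ[ℝ] Plane → ℝ where
  toFun q x := MvPolynomial.eval x.ofLp q.1
  map_add' q r := by ext x; simp
  map_smul' c q := by ext x; simp [MvPolynomial.smul_eval]

theorem contDiff_evalFun (q : Quad) : ContDiff ℝ ∞ (evalFun q) := by
  obtain ⟨q, hq⟩ := q
  simp only [evalFun, LinearMap.coe_mk, AddHom.coe_mk]
  clear hq
  induction q using MvPolynomial.induction_on with
  | C a => simpa using contDiff_const
  | add p q hp hq => simpa using hp.add hq
  | mul_X p i hp =>
    simp only [map_mul, MvPolynomial.eval_X]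
    exact hp.mul (by fun_prop)

theorem eq_zero_of_eqOn {U : Set Plane} (hU : IsOpen U) (hne : U.Nonempty) {q : Quad}
    (hq : ∀ x ∈ U, evalFun q x = 0) : q = 0 := by
  obtain ⟨x₀, hx₀⟩ := hne
  -- In the maximum norm a ball is a product of intervals, and a polynomial vanishing on a product
  -- of infinite sets is zero.
  have hU' : (WithLp.ofLp : Plane → Fin 2 → ℝ) '' U ∈ nhds x₀.ofLp :=
    ((PiLp.homeomorph 2 fun _ : Fin 2 => ℝ).isOpenMap U hU).mem_nhds ⟨x₀, hx₀, rfl⟩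
  obtain ⟨ε, hε, hball⟩ := Metric.nhds_basis_closedBall.mem_iff.1 hU'
  rw [closedBall_pi _ hε.le] at hball
  apply Subtype.ext
  refine MvPolynomial.funext_set (fun i => Metric.closedBall (x₀.ofLp i) ε) ?_ ?_
  · intro i
    rw [Real.closedBall_eq_Icc]
    exact Set.Icc_infinite (by linarith)
  · intro y hy
    obtain ⟨x, hx, rfl⟩ := hball hy
    exact (hq x hx).trans (map_zero _).symm

/-- The weighted `L²`-form on quadratic polynomials. -/
def weightForm (w : Plane → ℝ)
    (hw : ∀ f : Plane → ℝ, Continuous f → Integrable fun x => w x * f x) :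
    Quad →ₗ[ℝ] Quad →ₗ[ℝ] ℝ :=
  have hi (q s : Quad) : Integrable fun x => w x * (evalFun q x * evalFun s x) :=
    hw _ ((contDiff_evalFun q).continuous.mul (contDiff_evalFun s).continuous)
  LinearMap.mk₂ ℝ (fun q s => ∫ x, w x * (evalFun q x * evalFun s x))
    (fun q q' s => by
      rw [← integral_add (hi q s)
        (hi q' s)]
      congr 1; ext x; rw [map_add]; simp only [Pi.add_apply]; ring)
    (fun c q s => by
      rw [smul_eq_mul, ← integral_const_mul]
      congr 1; ext x; rw [map_smul]; simp only [Pi.smul_apply, smul_eq_mul]; ring)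
    (fun q s s' => by
      rw [← integral_add (hi q s)
        (hi q s')]
      congr 1; ext x; rw [map_add]; simp only [Pi.add_apply]; ring)
    (fun c q s => by
      rw [smul_eq_mul, ← integral_const_mul]
      congr 1; ext x; rw [map_smul]; simp only [Pi.smul_apply, smul_eq_mul]; ring)

theorem integrableOn_of_isBounded {U : Set Plane} (hb : Bornology.IsBounded U) {f : Plane → ℝ}
    (hf : Continuous f) : IntegrableOn f U :=
  (hf.continuousOn.integrableOn_compact hb.isCompact_closure).mono_set subset_closure

/-- On the open set `U` there are smooth functions with compact support that have the same moments
against quadratic polynomials as a given quadratic polynomial `q` and whose `L²`-norm and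
`H¹`-seminorm are controlled by the `L²`-norm of `q`. -/
def HasBubbles (U : Set Plane) (C L : ℝ) : Prop :=
  ∀ q : Quad, ∃ φ : Plane → ℝ, ContDiff ℝ ∞ φ ∧ HasCompactSupport φ ∧ tsupport φ ⊆ U ∧
    (∀ s : Quad, ∫ x in U, φ x * evalFun s x = ∫ x in U, evalFun q x * evalFun s x) ∧
    ∫ x in U, φ x ^ 2 ≤ C * ∫ x in U, evalFun q x ^ 2 ∧
    ∫ x in U, ‖gradient φ x‖ ^ 2 ≤ L * ∫ x in U, evalFun q x ^ 2

/-- Take a smooth bump $b\ge0$ supported in $U$ and seek $\varphi=b\,Rq$ with $Rq$ quadratic. The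
form $\int b\,rs$ is positive definite on quadratics, so the moment conditions determine $Rq$
uniquely and linearly in $q$. Both norm bounds then follow from finite dimensionality. -/
theorem exists_hasBubbles {U : Set Plane} (hU : IsOpen U) (hne : U.Nonempty)
    (hb : Bornology.IsBounded U) : ∃ C, 0 ≤ C ∧ HasBubbles U C C := by
  obtain ⟨x₀, hx₀⟩ := id hne
  obtain ⟨b, hbU, hbc, hbs, hb01, hbx⟩ :=
    exists_contDiff_tsupport_subset (n := ⊤) (hU.mem_nhds hx₀)
  have hb0 : ∀ x, 0 ≤ b x := fun x => (hb01 ⟨x, rfl⟩).1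
  have hbi (f : Plane → ℝ) (hf : Continuous f) : Integrable fun x => b x * f x :=
    (hbs.continuous.mul hf).integrable_of_hasCompactSupport hbc.mul_right
  have hUi (f : Plane → ℝ) (hf : Continuous f) :
      Integrable fun x => U.indicator (fun _ => (1 : ℝ)) x * f x := by
    have h := (integrable_indicator_iff hU.measurableSet).2 (integrableOn_of_isBounded hb hf)
    convert! h using 1
    ext x
    by_cases hx : x ∈ U <;> simp [hx]
  let B := weightForm b hbi
  let D := weightForm _ hUi
  -- If $\int b\,q^2=0$, the continuous integrand vanishes identically, so $q=0$ on the nonempty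
  -- open set where $b\ne0$.
  have hB0 (q : Quad) (hq : B q q = 0) : q = 0 := by
    by_contra hne
    have hcont : Continuous fun x => b x * (evalFun q x * evalFun q x) :=
      hbs.continuous.mul ((contDiff_evalFun q).continuous.mul (contDiff_evalFun q).continuous)
    have hzero : ∀ x, b x * (evalFun q x * evalFun q x) = 0 := by
      by_contra! h
      obtain ⟨x, hx⟩ := h
      exact (hcont.integral_pos_of_hasCompactSupport_nonneg_nonzero (μ := volume) hbc.mul_right
        (fun x => mul_nonneg (hb0 x) (mul_self_nonneg _)) hx).ne' hq
    refine hne (eq_zero_of_eqOn (U := {x | b x ≠ 0})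
      (isOpen_ne_fun hbs.continuous continuous_const) ⟨x₀, by simp [hbx]⟩ fun x hx => ?_)
    simpa [show b x ≠ 0 from hx] using hzero x
  have hBinj : Function.Injective B := by
    refine (injective_iff_map_eq_zero B).2 fun q hq => hB0 q ?_
    rw [hq]; rfl
  have hBbij : Function.Bijective B := ⟨hBinj,
    (LinearMap.injective_iff_surjective_of_finrank_eq_finrank
      (Subspace.dual_finrank_eq (K := ℝ) (V := Quad)).symm).1 hBinj⟩
  let R : Quad →ₗ[ℝ] Quad := (LinearEquiv.ofBijective B hBbij).symm.toLinearMap ∘ₗ D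
  have hR (q s : Quad) : B (R q) s = D q s :=
    congrArg (fun l => l s) ((LinearEquiv.ofBijective B hBbij).apply_symm_apply (D q))
  let Φ : Quad →ₗ[ℝ] Plane → ℝ := LinearMap.mulLeft ℝ b ∘ₗ evalFun ∘ₗ R
  have hΦ (q : Quad) (x : Plane) : Φ q x = b x * evalFun (R q) x := rfl
  have hΦs (q : Quad) : ContDiff ℝ ∞ (Φ q) := hbs.mul (contDiff_evalFun _)
  have hΦt (q : Quad) : tsupport (Φ q) ⊆ tsupport b := tsupport_mul_subset_left
  have hΦc (q : Quad) : HasCompactSupport (Φ q) := hbc.mul_right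
  have hd (q : Quad) : Differentiable ℝ (Φ q) := (hΦs q).differentiable (by simp)
  let Γ : Quad →ₗ[ℝ] Plane → Plane :=
    { toFun := fun q => gradient (Φ q)
      map_add' := fun q s => by
        ext1 x
        rw [map_add, Pi.add_apply, gradient, fderiv_add (hd q x) (hd s x), map_add]
        rfl
      map_smul' := fun c q => by
        ext1 x
        rw [map_smul, gradient, fderiv_const_smul (hd q x), map_smul]
        rfl }
  let A₁ := toLpLinear (μ := volume.restrict U) Φ
    fun q => (hΦs q).continuous.memLp_of_hasCompactSupport (hΦc q)
  let A₂ := toLpLinear (μ := volume.restrict U) Γ fun q =>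
    (continuous_gradient (hΦs q)).memLp_of_hasCompactSupport (hasCompactSupport_gradient (hΦc q))
  have hEm (q : Quad) : MemLp (evalFun q) 2 (volume.restrict U) := by
    rw [memLp_two_iff_integrable_sq (contDiff_evalFun q).continuous.aestronglyMeasurable]
    exact integrableOn_of_isBounded hb ((contDiff_evalFun q).continuous.pow 2)
  let J := toLpLinear (μ := volume.restrict U) evalFun hEm
  have hJ : Function.Injective J := by
    refine (injective_iff_map_eq_zero J).2 fun q hq => eq_zero_of_eqOn hU hne ?_
    have h1 : evalFun q =ᵐ[volume.restrict U] 0 :=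
      ((hEm q).coeFn_toLp.symm.trans (by
        rw [show (hEm q).toLp _ = 0 from hq]; exact Lp.coeFn_zero ℝ 2 _))
    exact Measure.eqOn_open_of_ae_eq h1 hU (contDiff_evalFun q).continuous.continuousOn
      continuousOn_const
  obtain ⟨C₁, hC₁⟩ := exists_norm_le_of_injective J hJ A₁
  obtain ⟨C₂, hC₂⟩ := exists_norm_le_of_injective J hJ A₂
  have hJq (q : Quad) : ‖J q‖ ^ 2 = ∫ x in U, evalFun q x ^ 2 := by
    rw [norm_toLpLinear_sq]; simp
  refine ⟨max (C₁ ^ 2) (C₂ ^ 2), by positivity, fun q => ⟨Φ q, hΦs q, hΦc q,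
    (hΦt q).trans hbU, fun s => ?_, ?_, ?_⟩⟩
  · have h := hR q s
    simp only [B, D, weightForm, LinearMap.mk₂_apply] at h
    rw [setIntegral_eq_integral_of_forall_compl_eq_zero]
    · simp only [hΦ, mul_assoc]
      rw [h, ← integral_indicator hU.measurableSet]
      congr 1
      ext x
      by_cases hx : x ∈ U <;> simp [hx]
    · intro x hx
      rw [image_eq_zero_of_notMem_tsupport fun h => hx (hbU (hΦt q h)), zero_mul]
  · have h := pow_le_pow_left₀ (norm_nonneg _) (hC₁ q) 2
    rw [mul_pow, hJq, norm_toLpLinear_sq] at h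
    simp only [Real.norm_eq_abs, sq_abs] at h
    exact h.trans (mul_le_mul_of_nonneg_right (le_max_left _ _)
      (integral_nonneg fun x => sq_nonneg _))
  · have h := pow_le_pow_left₀ (norm_nonneg _) (hC₂ q) 2
    rw [mul_pow, hJq, norm_toLpLinear_sq] at h
    exact h.trans (mul_le_mul_of_nonneg_right (le_max_right _ _)
      (integral_nonneg fun x => sq_nonneg _))

/-! ### Scaling -/

theorem exists_comp_affine (q : Quad) (a : Plane) (c : ℝ) :
    ∃ q' : Quad, ∀ x, evalFun q' x = evalFun q (a + c • x) := by
  let f : Fin 2 → MvPolynomial (Fin 2) ℝ := fun i =>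
    MvPolynomial.C (a i) + MvPolynomial.C c * MvPolynomial.X i
  have hf (i : Fin 2) : (f i).totalDegree ≤ 1 := by
    refine (MvPolynomial.totalDegree_add _ _).trans (max_le (by simp) ?_)
    exact (MvPolynomial.totalDegree_mul _ _).trans (by simp)
  refine ⟨⟨MvPolynomial.bind₁ f q.1, ?_⟩, fun x => ?_⟩
  · have hq := (MvPolynomial.mem_restrictTotalDegree _ _ _).1 q.2
    rw [MvPolynomial.mem_restrictTotalDegree]
    conv_lhs => rw [MvPolynomial.as_sum q.1]
    rw [map_sum]
    refine MvPolynomial.totalDegree_finsetSum_le fun d hd => ?_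
    rw [MvPolynomial.bind₁_monomial]
    refine (MvPolynomial.totalDegree_mul _ _).trans ?_
    rw [MvPolynomial.totalDegree_C, zero_add]
    refine (MvPolynomial.totalDegree_finsetProd _ _).trans ?_
    refine le_trans (Finset.sum_le_sum fun i _ => ?_) ((MvPolynomial.le_totalDegree hd).trans hq)
    exact (MvPolynomial.totalDegree_pow _ _).trans
      ((Nat.mul_le_mul_left _ (hf i)).trans (mul_one _).le)
  · simp only [evalFun, LinearMap.coe_mk, AddHom.coe_mk]
    rw [← MvPolynomial.aeval_eq_eval, MvPolynomial.aeval_bind₁, MvPolynomial.aeval_eq_eval]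
    congr 2
    ext i
    simp [f]

theorem setIntegral_vadd_smul (f : Plane → ℝ) (U : Set Plane) (a : Plane) {c : ℝ} (hc : c ≠ 0) :
    ∫ x in a +ᵥ c • U, f x = c ^ 2 * ∫ x in U, f (a + c • x) := by
  rw [Measure.setIntegral_comp_smul volume (fun x => f (a + x)) U hc, ← Set.image_vadd]
  have h := (measurePreserving_add_left (volume : Measure Plane) a).setIntegral_image_emb
    (measurableEmbedding_addLeft a) f (c • U)
  simp only [vadd_eq_add]
  rw [h, finrank_euclideanSpace_fin, smul_eq_mul, abs_of_nonneg (by positivity), ← mul_assoc,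
    mul_inv_cancel₀ (by positivity), one_mul]

theorem gradient_comp_homothety {φ : Plane → ℝ} (hφ : Differentiable ℝ φ) (a : Plane) (c : ℝ)
    (x : Plane) : gradient (fun y => φ (c • (y - a))) x = c • gradient φ (c • (x - a)) := by
  have h1 : HasFDerivAt (fun y : Plane => c • (y - a)) (c • ContinuousLinearMap.id ℝ Plane) x :=
    ((hasFDerivAt_id x).sub_const a).const_smul c
  have h2 := (hφ (c • (x - a))).hasFDerivAt.comp x h1
  rw [gradient, gradient, show fderiv ℝ (fun y => φ (c • (y - a))) x = _ from h2.fderiv,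
    ContinuousLinearMap.comp_smul, ContinuousLinearMap.comp_id, map_smul]

/-- The bubble is transported as $\varphi(c^{-1}(y-a))$. The area factor $c^2$ occurs on both sides
of each relation and cancels; only the gradient bound picks up $c^{-2}$. -/
theorem HasBubbles.homothetic {U : Set Plane} {C L : ℝ} (h : HasBubbles U C L) (a : Plane) {c : ℝ}
    (hc : c ≠ 0) : HasBubbles (a +ᵥ c • U) C (L / c ^ 2) := by
  intro q
  obtain ⟨q', hq'⟩ := exists_comp_affine q a c
  obtain ⟨φ, hφ, hφc, hφU, hmom, hφ0, hφ1⟩ := h q'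
  have hinv (x : Plane) : c⁻¹ • (a + c • x - a) = x := by
    rw [add_sub_cancel_left, smul_smul, inv_mul_cancel₀ hc, one_smul]
  have hinv' (x : Plane) : a + c • (c⁻¹ • (x - a)) = x := by
    rw [smul_smul, mul_inv_cancel₀ hc, one_smul, add_sub_cancel]
  let e : Plane ≃ₜ Plane :=
    (Homeomorph.subRight a).trans (Homeomorph.smulOfNeZero c⁻¹ (inv_ne_zero hc))
  have he (x : Plane) : e x = c⁻¹ • (x - a) := rfl
  refine ⟨fun y => φ (c⁻¹ • (y - a)), hφ.comp (by fun_prop), hφc.comp_homeomorph e, ?_, ?_, ?_, ?_⟩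
  · intro x hx
    have h1 : tsupport (φ ∘ e) = e ⁻¹' tsupport φ := tsupport_comp_eq_preimage φ e
    have h2 : e x ∈ tsupport φ := by
      rw [← Set.mem_preimage, ← h1]; exact hx
    exact ⟨c • e x, ⟨e x, hφU h2, rfl⟩, hinv' x⟩
  · intro s
    obtain ⟨s', hs'⟩ := exists_comp_affine s a c
    rw [setIntegral_vadd_smul _ _ _ hc, setIntegral_vadd_smul _ _ _ hc]
    simp only [hinv, ← hq', ← hs', hmom]
  · rw [setIntegral_vadd_smul _ _ _ hc, setIntegral_vadd_smul _ _ _ hc]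
    simp only [hinv, ← hq']
    rw [mul_left_comm]
    exact mul_le_mul_of_nonneg_left hφ0 (sq_nonneg c)
  · rw [setIntegral_vadd_smul _ _ _ hc, setIntegral_vadd_smul _ _ _ hc]
    simp only [gradient_comp_homothety (hφ.differentiable (by simp)), hinv, ← hq', norm_smul,
      mul_pow, integral_const_mul, norm_inv, inv_pow, Real.norm_eq_abs, sq_abs]
    rw [← mul_assoc, mul_inv_cancel₀ (pow_ne_zero 2 hc), one_mul, ← mul_assoc,
      div_mul_cancel₀ _ (pow_ne_zero 2 hc)]
    exact hφ1

theorem HasBubbles.mono {U : Set Plane} {C L C' L' : ℝ} (h : HasBubbles U C L) (hC : C ≤ C')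
    (hL : L ≤ L') : HasBubbles U C' L' := by
  intro q
  obtain ⟨φ, hφ, hφc, hφU, hmom, hφ0, hφ1⟩ := h q
  have h0 : 0 ≤ ∫ x in U, evalFun q x ^ 2 := integral_nonneg fun x => sq_nonneg _
  exact ⟨φ, hφ, hφc, hφU, hmom, hφ0.trans (mul_le_mul_of_nonneg_right hC h0),
    hφ1.trans (mul_le_mul_of_nonneg_right hL h0)⟩

/-- Bubble functions exist on all elements of a sequence of uniformly refined grids, with the
natural scaling of the constants. -/
theorem GridSequence.exists_hasBubbles (G : GridSequence Ω) :
    ∃ C, 0 ≤ C ∧ ∀ k, ∀ t ∈ triangles (G.grid k), HasBubbles (cell t) C (C * (2 ^ k) ^ 2) := by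
  have h (t : Finset Plane) : ∃ C, 0 ≤ C ∧ (t ∈ triangles (G.grid 0) → HasBubbles (cell t) C C) := by
    by_cases ht : t ∈ triangles (G.grid 0)
    · obtain ⟨C, hC, hb⟩ := GenStokes.exists_hasBubbles isOpen_interior (cell_nonempty ht)
        (isBounded_cell t)
      exact ⟨C, hC, fun _ => hb⟩
    · exact ⟨0, le_rfl, fun h => absurd h ht⟩
  choose C hC hb using h
  have hfin := (G.isGrid 0).finite_triangles
  -- The sum over the initial triangles serves as an upper bound for each of their constants.
  refine ⟨∑ t ∈ hfin.toFinset, C t, Finset.sum_nonneg fun t _ => hC t, fun k t ht => ?_⟩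
  obtain ⟨t₀, ht₀, a, c, hc, h⟩ := G.exists_homothetic k t ht
  have hle : C t₀ ≤ ∑ t ∈ hfin.toFinset, C t :=
    Finset.single_le_sum (fun t _ => hC t) (by simpa using ht₀)
  have hc0 : c ≠ 0 := by
    rw [← abs_pos, hc]; positivity
  rw [cell_homothetic hc0 h]
  refine ((hb t₀ ht₀).homothetic a hc0).mono hle ?_
  rw [← sq_abs, hc, div_eq_mul_inv, inv_pow, inv_pow, inv_inv]
  exact mul_le_mul_of_nonneg_right hle (by positivity)

/-! ### Test functions -/

/-- A smooth function with compact support in `Ω` represents an element of `H¹₀(Ω)`. -/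
theorem exists_H10 {F : Plane → ℝ} (hF : ContDiff ℝ ∞ F) (hFc : HasCompactSupport F)
    (hFΩ : tsupport F ⊆ Ω.carrier) :
    ∃ w : H10 Ω, toL2 Ω w =ᵐ[Ω.vol] F ∧ ‖toL2 Ω w‖ ^ 2 = ∫ x, F x ^ 2 ∂Ω.vol ∧
      ‖w‖ ^ 2 = ∫ x, F x ^ 2 ∂Ω.vol + ∫ x, ‖gradient F x‖ ^ 2 ∂Ω.vol := by
  have h0 : MemLp F 2 Ω.vol := hF.continuous.memLp_of_hasCompactSupport hFc
  have h1 : MemLp (gradient F) 2 Ω.vol :=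
    (continuous_gradient hF).memLp_of_hasCompactSupport (hasCompactSupport_gradient hFc)
  have h0sq : ‖h0.toLp F‖ ^ 2 = ∫ x, F x ^ 2 ∂Ω.vol := by
    simpa only [Real.norm_eq_abs, sq_abs] using norm_toLp_sq h0
  let v : FunGrad Ω := WithLp.toLp 2 (h0.toLp F, h1.toLp (gradient F))
  have hv : v ∈ H10 Ω := Submodule.le_topologicalClosure _ (Submodule.subset_span
    ⟨F, hF, hFc, hFΩ, h0.coeFn_toLp, h1.coeFn_toLp⟩)
  refine ⟨⟨v, hv⟩, h0.coeFn_toLp, h0sq, ?_⟩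
  rw [Submodule.coe_norm, WithLp.prod_norm_sq_eq_of_L2, ← h0sq, ← norm_toLp_sq h1]
  rfl

/-- A Lagrange function of degree at most two is a quadratic polynomial on every element. -/
theorem exists_quad {f : Plane → ℝ} {d : ℕ} (hd : d ≤ 2) (hf : f ∈ lagrange K d)
    {t : Finset Plane} (ht : t ∈ triangles K) : ∃ q : Quad, ∀ x ∈ cell t, f x = evalFun q x := by
  obtain ⟨q, hq, hfq⟩ := hf.2 t ht
  exact ⟨⟨q, (MvPolynomial.mem_restrictTotalDegree _ _ _).2 (hq.trans hd)⟩,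
    fun x hx => hfq x (interior_subset hx)⟩

/-- The bubbles of the separate elements have disjoint supports, so all integrals of their sum and
of its gradient split over the elements. -/
theorem IsGrid.exists_test (hK : IsGrid Ω K) {C L : ℝ}
    (hb : ∀ t ∈ triangles K, HasBubbles (cell t) C L) {p : L2 Ω} {f : Plane → ℝ} {d : ℕ}
    (hd : d ≤ 2) (hf : f ∈ lagrange K d) (hpf : p =ᵐ[Ω.vol] f) :
    ∃ w : H10 Ω, ⟪p, toL2 Ω w⟫ = ‖p‖ ^ 2 ∧ ∫ x, toL2 Ω w x ∂Ω.vol = ∫ x, p x ∂Ω.vol ∧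
      ‖toL2 Ω w‖ ^ 2 ≤ C * ‖p‖ ^ 2 ∧ ‖w‖ ^ 2 ≤ (C + L) * ‖p‖ ^ 2 := by
  have hex (t : Finset Plane) : ∃ (q : Quad) (φ : Plane → ℝ), t ∈ triangles K →
      (∀ x ∈ cell t, f x = evalFun q x) ∧
      ContDiff ℝ ∞ φ ∧ HasCompactSupport φ ∧ tsupport φ ⊆ cell t ∧
      (∀ s : Quad, ∫ x in cell t, φ x * evalFun s x = ∫ x in cell t, evalFun q x * evalFun s x) ∧
      ∫ x in cell t, φ x ^ 2 ≤ C * ∫ x in cell t, evalFun q x ^ 2 ∧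
      ∫ x in cell t, ‖gradient φ x‖ ^ 2 ≤ L * ∫ x in cell t, evalFun q x ^ 2 := by
    by_cases ht : t ∈ triangles K
    · obtain ⟨q, hq⟩ := exists_quad hd hf ht
      obtain ⟨φ, hφ⟩ := hb t ht q
      exact ⟨q, φ, fun _ => ⟨hq, hφ⟩⟩
    · exact ⟨0, 0, fun h => absurd h ht⟩
  choose q φ h using hex
  set S := hK.finite_triangles.toFinset
  have hmem {t} (ht : t ∈ S) : t ∈ triangles K := by simpa [S] using ht
  let F : Plane → ℝ := fun x => ∑ t ∈ S, φ t x
  have hF : ContDiff ℝ ∞ F := ContDiff.sum fun t ht => (h t (hmem ht)).2.1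
  have hZ : IsCompact (⋃ t ∈ S, tsupport (φ t)) :=
    S.isCompact_biUnion fun t ht => (h t (hmem ht)).2.2.1
  have hFZ : tsupport F ⊆ ⋃ t ∈ S, tsupport (φ t) := by
    refine closure_minimal (fun x hx => ?_) hZ.isClosed
    obtain ⟨t, ht, hne⟩ := Finset.exists_ne_zero_of_sum_ne_zero hx
    exact Set.mem_biUnion ht (subset_tsupport _ hne)
  have hFc : HasCompactSupport F := hZ.of_isClosed_subset (isClosed_tsupport F) hFZ
  have hFΩ : tsupport F ⊆ Ω.carrier := hFZ.trans (Set.iUnion₂_subset fun t ht =>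
    (h t (hmem ht)).2.2.2.1.trans (hK.cell_subset (hmem ht)))
  have hFφ {t} (ht : t ∈ S) : ∀ x ∈ cell t, F x = φ t x := by
    intro x hx
    refine Finset.sum_eq_single_of_mem t ht fun s hs hst => ?_
    refine image_eq_zero_of_notMem_tsupport fun hxs => ?_
    exact Set.disjoint_left.1 (cell_disjoint (hmem hs) (hmem ht) hst)
      ((h s (hmem hs)).2.2.2.1 hxs) hx
  have hgφ {t} (ht : t ∈ S) : ∀ x ∈ cell t, gradient F x = gradient (φ t) x := by
    intro x hx
    refine Filter.EventuallyEq.gradient_eq ?_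
    filter_upwards [isOpen_interior.mem_nhds hx] with y hy using hFφ ht y hy
  have hmeas (t : Finset Plane) : MeasurableSet (cell t) := isOpen_interior.measurableSet
  obtain ⟨w, hwF, hw0, hw1⟩ := exists_H10 hF hFc hFΩ
  have hfL : MemLp f 2 Ω.vol := (Lp.memLp p).ae_eq hpf
  have hFL : MemLp F 2 Ω.vol := hF.continuous.memLp_of_hasCompactSupport hFc
  have hgL : MemLp (gradient F) 2 Ω.vol :=
    (continuous_gradient hF).memLp_of_hasCompactSupport (hasCompactSupport_gradient hFc)
  have hp2 : ‖p‖ ^ 2 = ∑ t ∈ S, ∫ x in cell t, evalFun (q t) x ^ 2 := by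
    rw [L2_norm_sq, ← Finset.sum_congr rfl fun t ht =>
      setIntegral_congr_fun (hmeas t) fun x hx => congrArg (· ^ 2) ((h t (hmem ht)).1 x hx),
      ← hK.setIntegral_eq hfL.integrable_sq]
    refine integral_congr_ae ?_
    filter_upwards [hpf] with x hx
    rw [hx, Real.norm_eq_abs, sq_abs]
  have hF2 : ∫ x, F x ^ 2 ∂Ω.vol ≤ C * ‖p‖ ^ 2 := by
    rw [hK.setIntegral_eq hFL.integrable_sq, hp2, Finset.mul_sum]
    refine Finset.sum_le_sum fun t ht => ?_
    rw [setIntegral_congr_fun (hmeas t) fun x hx => congrArg (· ^ 2) (hFφ ht x hx)]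
    exact (h t (hmem ht)).2.2.2.2.2.1
  have hG2 : ∫ x, ‖gradient F x‖ ^ 2 ∂Ω.vol ≤ L * ‖p‖ ^ 2 := by
    rw [hK.setIntegral_eq (hgL.integrable_norm_pow two_ne_zero), hp2, Finset.mul_sum]
    refine Finset.sum_le_sum fun t ht => ?_
    refine Eq.trans_le (setIntegral_congr_fun (hmeas t) fun x hx => ?_)
      (h t (hmem ht)).2.2.2.2.2.2
    exact congrArg (fun v : Plane => ‖v‖ ^ 2) (hgφ ht x hx)
  refine ⟨w, ?_, ?_, hw0.trans_le hF2, by rw [hw1, add_mul]; exact add_le_add hF2 hG2⟩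
  -- On each element the moment condition is used against the polynomial representing $f$ itself.
  · have h1 : ⟪p, toL2 Ω w⟫ = ∫ x, F x * f x ∂Ω.vol := by
      rw [L2.inner_def]
      refine integral_congr_ae ?_
      filter_upwards [hpf, hwF] with x hx hx'
      rw [hx, hx']
      simp
    rw [h1, hK.setIntegral_eq (f := fun x => F x * f x) (hFL.integrable_mul hfL), hp2]
    refine Finset.sum_congr rfl fun t ht => ?_
    rw [setIntegral_congr_fun (g := fun x => φ t x * evalFun (q t) x) (hmeas t) fun x hx => by
      simp only [hFφ ht x hx, (h t (hmem ht)).1 x hx], (h t (hmem ht)).2.2.2.2.1]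
    simp only [sq]
  · rw [integral_congr_ae hwF, integral_congr_ae hpf,
      hK.setIntegral_eq (hFL.integrable one_le_two), hK.setIntegral_eq (hfL.integrable one_le_two)]
    refine Finset.sum_congr rfl fun t ht => ?_
    -- The moment against the constant $1$ preserves the mean value.
    let e : Quad := ⟨1, by simp [MvPolynomial.mem_restrictTotalDegree]⟩
    have he (x : Plane) : evalFun e x = 1 := by simp [evalFun, e]
    rw [setIntegral_congr_fun (hmeas t) (hFφ ht),
      setIntegral_congr_fun (hmeas t) (h t (hmem ht)).1]
    simpa only [he, mul_one] using (h t (hmem ht)).2.2.2.2.1 e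

/-! ### Duality -/

theorem le_of_sq_le_mul {a b D : ℝ} (ha : 0 ≤ a) (h : a ^ 2 ≤ b) (hb : b ^ 2 ≤ D * a ^ 2)
    (hD : 0 ≤ D) : a ^ 2 ≤ D := by
  rcases ha.eq_or_lt with rfl | ha
  · simpa using hD
  · have h1 : a ^ 2 * a ^ 2 ≤ D * a ^ 2 := by
      rw [← sq]
      exact (pow_le_pow_left₀ (sq_nonneg a) h 2).trans hb
    exact le_of_mul_le_mul_right h1 (by positivity)

/-- The inverse inequality between the `L²`-norm and the norm of `[H¹₀]^*`. -/
theorem norm_sq_le_dual {D : ℝ} (hD : 0 ≤ D) (u : L2Vec Ω)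
    (h : ∀ i, ∃ w : H10 Ω, ⟪u i, toL2 Ω w⟫ = ‖u i‖ ^ 2 ∧ ‖w‖ ^ 2 ≤ D * ‖u i‖ ^ 2) :
    ‖u‖ ^ 2 ≤ D * ‖toH10VecDual Ω u‖ ^ 2 := by
  choose w hw hwn using h
  let W : H10Vec Ω := WithLp.toLp 2 w
  have hW : ‖W‖ ^ 2 ≤ D * ‖u‖ ^ 2 := by
    rw [PiLp.norm_sq_eq_of_L2, PiLp.norm_sq_eq_of_L2, Finset.mul_sum]
    exact Finset.sum_le_sum fun i _ => hwn i
  have hu : toH10VecDual Ω u W = ‖u‖ ^ 2 := by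
    rw [PiLp.norm_sq_eq_of_L2, toH10VecDual, sum_apply]
    exact Finset.sum_congr rfl fun i _ => hw i
  refine le_of_sq_le_mul (norm_nonneg u) (b := ‖toH10VecDual Ω u‖ * ‖W‖) ?_ ?_ (by positivity)
  · rw [← hu]
    exact (le_abs_self _).trans ((toH10VecDual Ω u).le_opNorm W)
  · rw [mul_pow, mul_comm D, mul_assoc]
    exact mul_le_mul_of_nonneg_left hW (sq_nonneg _)

/-- The decomposition holds only on functions with mean value zero; `w` inherits that property from
`p`, so it may be inserted. Keeping its $L^2$- and $H^1$-bounds apart leaves the coefficient of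
$\|r\|^2$ free of $h_k^{-2}$. -/
theorem norm_sq_le_of_decomposition {C D : ℝ} (hC : 0 ≤ C) (hD : 0 ≤ D) {p : L2 Ω}
    (hp : p ∈ L20 Ω) {w : H10 Ω} (hw : ⟪p, toL2 Ω w⟫ = ‖p‖ ^ 2)
    (hwp : ∫ x, toL2 Ω w x ∂Ω.vol = ∫ x, p x ∂Ω.vol) (hw0 : ‖toL2 Ω w‖ ^ 2 ≤ C * ‖p‖ ^ 2)
    (hw1 : ‖w‖ ^ 2 ≤ D * ‖p‖ ^ 2) {ℓ : StrongDual ℝ (H10 Ω)} {r : L20 Ω}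
    (h : toPMinus Ω p = ℓ.comp (H10L20 Ω).subtypeL + toPMinus Ω r) :
    ‖p‖ ^ 2 ≤ 2 * (D * ‖ℓ‖ ^ 2 + C * ‖r‖ ^ 2) := by
  have hw20 : w ∈ H10L20 Ω := hwp.trans hp
  have h1 : ⟪p, toL2 Ω w⟫ = ℓ w + ⟪(r : L2 Ω), toL2 Ω w⟫ :=
    congrArg (fun F => F ⟨w, hw20⟩) h
  refine le_of_sq_le_mul (norm_nonneg p) (b := ‖ℓ‖ * ‖w‖ + ‖r‖ * ‖toL2 Ω w‖) ?_ ?_ (by positivity)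
  · rw [← hw, h1]
    exact add_le_add ((le_abs_self _).trans (ℓ.le_opNorm w)) (real_inner_le_norm _ _)
  · have h2 := mul_le_mul_of_nonneg_left hw0 (sq_nonneg ‖r‖)
    have h3 := mul_le_mul_of_nonneg_left hw1 (sq_nonneg ‖ℓ‖)
    refine (add_sq_le (a := ‖ℓ‖ * ‖w‖)).trans ?_
    rw [mul_pow, mul_pow]
    linarith

theorem le_sumNormSq {E β η : ℝ} (hβ : 0 < β) (hE : 0 < E) (hη : 0 ≤ η) {p : L2 Ω}
    (hp : p ∈ L20 Ω)
    (h : ∀ (ℓ : StrongDual ℝ (H10 Ω)) (r : L20 Ω),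
      toPMinus Ω p = ℓ.comp (H10L20 Ω).subtypeL + toPMinus Ω r →
        ‖p‖ ^ 2 ≤ E * (η * ‖ℓ‖ ^ 2 + ‖r‖ ^ 2)) :
    (β + η)⁻¹ * ‖p‖ ^ 2 ≤ E * sumNormSq Ω β (toPMinus Ω p) := by
  rw [← div_le_iff₀' hE]
  -- The decomposition $\ell=0$, $r=p$ shows that the infimum is over a nonempty set.
  refine le_csInf ⟨_, 0, ⟨p, hp⟩, by simp, rfl⟩ ?_
  rintro m ⟨ℓ, r, hF, rfl⟩
  have h1 := h ℓ r hF
  rw [div_le_iff₀' hE, inv_mul_le_iff₀ (by positivity)]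
  refine h1.trans ?_
  rw [mul_left_comm]
  refine mul_le_mul_of_nonneg_left ?_ hE.le
  -- The weight $(\beta+\eta)^{-1}$ fits because expanding this product yields
  -- $\eta\|\ell\|^2+\|r\|^2$ plus nonnegative terms.
  have h2 : (β + η) * (‖ℓ‖ ^ 2 + β⁻¹ * ‖r‖ ^ 2) =
      η * ‖ℓ‖ ^ 2 + ‖r‖ ^ 2 + (β * ‖ℓ‖ ^ 2 + η * β⁻¹ * ‖r‖ ^ 2) := by
    field_simp
    ring
  rw [h2]
  exact le_add_of_nonneg_right (by positivity)

end GenStokes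

end

/-! ### Assembling the velocity and pressure estimates -/

open GenStokes in
theorem mainTheorem5 (Ω : PolygonalDomain) (G : GridSequence Ω)
    (hG : ∀ k, ∀ t ∈ triangles (G.grid k), ∃ v ∈ t, v ∈ Ω.carrier) :
    ∃ C : ℝ, 0 < C ∧ ∀ (k : ℕ) (β : ℝ), 0 < β →
      ∀ u ∈ velocitySpace Ω (G.grid k), ∀ p ∈ pressureSpace Ω (G.grid k),
        scaledNorm Ω (gridSize (G.grid k)) β u p ≤
          C * weakNorm Ω (gridSize (G.grid k)) β u (toPMinus Ω p) := by
  obtain ⟨C, hC, hb⟩ := G.exists_hasBubbles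
  set h₀ := gridSize (G.grid 0)
  -- From $C+C4^k\le 2C4^k\le 2Ch_0^2h_k^{-2}$.
  set D := 2 * C * h₀ ^ 2 with hD
  have hD0 : 0 ≤ D := by positivity
  -- Dominates $2D$ and $2C$ for the pressure, and $D$ and $1$ for the velocity; the summand $1$
  -- also makes it positive.
  set E := 2 * (D + C) + 1 with hE
  have hE0 : 0 < E := by positivity
  refine ⟨√E, Real.sqrt_pos.2 hE0, fun k β hβ u hu p hp => ?_⟩
  have hK := G.isGrid k
  set h := gridSize (G.grid k)
  have hpos : 0 < h := gridSize_pos hK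
  set η := (h ^ 2)⁻¹ with hη
  have hη0 : 0 < η := by positivity
  have hscale : C + C * (2 ^ k) ^ 2 ≤ D * η := by
    have h1 : h * 2 ^ k ≤ h₀ := by
      have h2 := mul_le_mul_of_nonneg_right (G.gridSize_le k) (by positivity : (0 : ℝ) ≤ 2 ^ k)
      rwa [mul_right_comm, ← mul_pow, inv_mul_cancel₀ two_ne_zero, one_pow, one_mul] at h2
    have h2 : (2 ^ k) ^ 2 ≤ h₀ ^ 2 * η := by
      rw [hη, le_mul_inv_iff₀ (by positivity), ← mul_pow, mul_comm]
      exact pow_le_pow_left₀ (by positivity) h1 2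
    have h3 : (1 : ℝ) ≤ (2 ^ k) ^ 2 := one_le_pow₀ (one_le_pow₀ one_le_two)
    have h4 := mul_le_mul_of_nonneg_left h2 hC
    have h5 := mul_le_mul_of_nonneg_left h3 hC
    rw [hD]
    linarith
  have hU : ‖u‖ ^ 2 ≤ D * η * ‖toH10VecDual Ω u‖ ^ 2 := by
    refine norm_sq_le_dual (by positivity) u fun i => ?_
    obtain ⟨f, hf, -, huf⟩ := hu i
    obtain ⟨w, hw, -, -, hw1⟩ := hK.exists_test (hb k) le_rfl hf huf
    exact ⟨w, hw, hw1.trans (mul_le_mul_of_nonneg_right hscale (sq_nonneg _))⟩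
  have hP : (β + η)⁻¹ * ‖p‖ ^ 2 ≤ E * sumNormSq Ω β (toPMinus Ω p) := by
    obtain ⟨hp0, f, hf, hpf⟩ := hp
    obtain ⟨w, hw, hwp, hw0, hw1⟩ := hK.exists_test (hb k) one_le_two hf hpf
    refine le_sumNormSq hβ hE0 hη0.le hp0 fun ℓ r hF => ?_
    refine (norm_sq_le_of_decomposition hC (by positivity) hp0 hw hwp hw0
      (hw1.trans (mul_le_mul_of_nonneg_right hscale (sq_nonneg _))) hF).trans ?_
    have h1 : E * (η * ‖ℓ‖ ^ 2 + ‖r‖ ^ 2) = 2 * (D * η * ‖ℓ‖ ^ 2 + C * ‖r‖ ^ 2) +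
        ((2 * C + 1) * η * ‖ℓ‖ ^ 2 + (2 * D + 1) * ‖r‖ ^ 2) := by
      rw [hE]; ring
    rw [h1]
    exact le_add_of_nonneg_right (by positivity)
  rw [scaledNorm, weakNorm, ← Real.sqrt_mul hE0.le]
  refine Real.sqrt_le_sqrt ?_
  have h1 := mul_le_mul_of_nonneg_left hU hβ.le
  have h2 := mul_le_mul_of_nonneg_left hP hη0.le
  -- The term $\eta\|u\|^2$ occurs in both norms; only $\beta\|u\|^2$ has to be traded, through the
  -- inverse inequality, for the dual norm.
  have h3 : E * (η * interNormSq Ω β u) = η * ‖u‖ ^ 2 + β * (D * η * ‖toH10VecDual Ω u‖ ^ 2) +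
      (2 * (D + C) * η * ‖u‖ ^ 2 + (D + 2 * C + 1) * (β * η * ‖toH10VecDual Ω u‖ ^ 2)) := by
    rw [interNormSq, hE]; ring
  have h4 : 0 ≤ 2 * (D + C) * η * ‖u‖ ^ 2 +
      (D + 2 * C + 1) * (β * η * ‖toH10VecDual Ω u‖ ^ 2) := by positivity
  rw [mul_add, h3]
  linarith
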